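/- Let $\mathcal S^{n}$ be the space of real symmetric $n\times n$ matrices with the Frobenius norm $\|\cdot\|_F$, $\mathcal O(n)$ the orthogonal group, and $\mathbb R^n_{\ge}=\{x\in\mathbb R^n : x_1\ge x_2\ge\cdots\ge x_n\}$ with the Euclidean norm $\|\cdot\|$. For $X\in\mathcal S^n$ let $\lambda(X)\in\mathbb R^n_{\ge}$ be the vector of eigenvalues of $X$, with multiplicity, in descending order. Let $F:\mathcal S^n\to\mathbb R$ and $G:\mathcal S^n\to\mathbb R^p$ be functions, let $C\subseteq\mathbb R^n$ be a set (for instance a closed set), and put $$\mathcal X_1=\{X\in\mathcal S^n : G(X)=0,\ \lambda(X)\in C\},$$ $$\mathcal X_2=\{(Q,\lambda)\in\mathcal O(n)\times\mathbb R^n_{\ge} : G(Q\operatorname{Diag}(\lambda)Q^\top)=0,\ \lambda\in C\},$$ $$f(Q,\lambda)=F(Q\operatorname{Diag}(\lambda)Q^\top).$$ Call $X^*\in\mathcal S^n$ a local minimum of the symmetric problem $\min_{\mathcal X_1}F$ if there is $\delta>0$ such that $F(X^*)\le F(X)$ for all $X\in\mathcal X_1$ with $\|X-X^*\|_F\le\delta$.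 Call $(Q^*,\lambda^*)\in\mathcal O(n)\times\mathbb R^n_{\ge}$ a local minimum of the decomposed problem $\min_{\mathcal X_2}f$ if there is $\delta>0$ such that $f(Q^*,\lambda^*)\le f(Q,\lambda)$ for all $(Q,\lambda)\in\mathcal X_2$ with $\|Q-Q^*\|_F\le\delta$ and $\|\lambda-\lambda^*\|\le\delta$. A spectral decomposition of $X$ is a pair $(Q,\lambda)\in\mathcal O(n)\times\mathbb R^n_{\ge}$ with $X=Q\operatorname{Diag}(\lambda)Q^\top$. Theorem. Let $X^*\in\mathcal S^n$ have pairwise distinct eigenvalues. Then $X^*$ is a local minimum of the symmetric problem if and only if one of its spectral decompositions is a local minimum of the decomposed problem. Furthermore, if one spectral decomposition of $X^*$ is a local minimum of the decomposed problem, then all of its spectral decompositions are. Finally, for every spectral decomposition $(Q,\lambda)$ of $X^*$ one has $X^*\in\mathcal X_1$ if and only if $(Q,\lambda)\in\mathcal X_2$, so that the two previous assertions hold equally when local minima are required to be feasible. -/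

import Mathlib

namespace SpecOpt

/-- The space of real symmetric `n × n` matrices. -/
abbrev SymMat (n : ℕ) : Type :=
  {X : Matrix (Fin n) (Fin n) ℝ // X.IsSymm}

/-- The vectors of `ℝⁿ` with entries in decreasing order, `x₁ ≥ x₂ ≥ ⋯ ≥ xₙ`. -/
abbrev OrderedVec (n : ℕ) : Type :=
  {x : EuclideanSpace ℝ (Fin n) // Antitone (fun i => x i)}

/-- The orthogonal group `O(n)`. -/
abbrev Orth (n : ℕ) : Type :=
  Matrix.orthogonalGroup (Fin n) ℝ

theorem SymMat.isHermitian {n : ℕ} (X : SymMat n) : X.1.IsHermitian := by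
  have h : X.1.transpose = X.1 := X.2
  rw [Matrix.IsHermitian, Matrix.conjTranspose_eq_transpose_of_trivial, h]

/-- The vector `λ(X)` of eigenvalues of `X`, with multiplicity, in descending order. -/
noncomputable def eigenvalueVec {n : ℕ} (X : SymMat n) : EuclideanSpace ℝ (Fin n) :=
  WithLp.toLp 2 fun i => X.isHermitian.eigenvalues₀ (Fin.cast (Fintype.card_fin n).symm i)

/-- All eigenvalues of `X` are distinct. -/
def HasDistinctEigenvalues {n : ℕ} (X : SymMat n) : Prop :=
  Function.Injective (fun i => eigenvalueVec X i)

/-- The symmetric matrix `Q Diag(l) Qᵀ`. -/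
def compose {n : ℕ} (Q : Orth n) (l : EuclideanSpace ℝ (Fin n)) : SymMat n :=
  ⟨Q.1 * Matrix.diagonal (fun i => l i) * Q.1.transpose, by
    simp [Matrix.IsSymm, Matrix.transpose_mul, Matrix.mul_assoc]⟩

/-- `(Q, l) ∈ O(n) × ℝⁿ_≥` is a spectral decomposition of `X`. -/
def IsSpectralDecomposition {n : ℕ} (X : SymMat n) (P : Orth n × OrderedVec n) : Prop :=
  X = compose P.1 P.2.1

/-- The Frobenius distance between two real matrices. -/
noncomputable def frobDist {n : ℕ} (A B : Matrix (Fin n) (Fin n) ℝ) : ℝ :=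
  letI := @Matrix.frobeniusNormedAddCommGroup (Fin n) (Fin n) ℝ _ _ _
  ‖A - B‖

/-- The feasible set `{X | G(X) = 0, λ(X) ∈ C}` of the symmetric matrix problem. -/
def feasibleSym {n p : ℕ} (G : SymMat n → EuclideanSpace ℝ (Fin p))
    (C : Set (EuclideanSpace ℝ (Fin n))) : Set (SymMat n) :=
  {X | G X = 0 ∧ eigenvalueVec X ∈ C}

/-- The feasible set `{(Q, l) ∈ O(n) × ℝⁿ_≥ | G(Q Diag(l) Qᵀ) = 0, l ∈ C}` of the decomposed
problem. -/
def feasibleDecomp {n p : ℕ} (G : SymMat n → EuclideanSpace ℝ (Fin p))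
    (C : Set (EuclideanSpace ℝ (Fin n))) : Set (Orth n × OrderedVec n) :=
  {P | G (compose P.1 P.2.1) = 0 ∧ P.2.1 ∈ C}

/-- `X` is a local minimum of `F` over the feasible set of the symmetric matrix problem. -/
def IsLocalMinSym {n p : ℕ} (F : SymMat n → ℝ) (G : SymMat n → EuclideanSpace ℝ (Fin p))
    (C : Set (EuclideanSpace ℝ (Fin n))) (X : SymMat n) : Prop :=
  ∃ δ : ℝ, 0 < δ ∧ ∀ Y ∈ feasibleSym G C, frobDist Y.1 X.1 ≤ δ → F X ≤ F Y

/-- `P = (Q, l)` is a local minimum of `f(Q, l) = F(Q Diag(l) Qᵀ)` over the feasible set of the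
decomposed problem. -/
def IsLocalMinDecomp {n p : ℕ} (F : SymMat n → ℝ) (G : SymMat n → EuclideanSpace ℝ (Fin p))
    (C : Set (EuclideanSpace ℝ (Fin n))) (P : Orth n × OrderedVec n) : Prop :=
  ∃ δ : ℝ, 0 < δ ∧ ∀ R ∈ feasibleDecomp G C,
    frobDist R.1.1 P.1.1 ≤ δ → ‖R.2.1 - P.2.1‖ ≤ δ →
      F (compose P.1 P.2.1) ≤ F (compose R.1 R.2.1)

end SpecOpt

/-!
The recomposition map `(Q, l) ↦ Q Diag(l) Qᵀ` is a continuous closed surjection: it is conjugation,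
a closed map because `O(n)` is compact, precomposed with the closed embedding `l ↦ Diag(l)`. For
such a map `f`, the neighbourhoods of a fibre `f ⁻¹' {y}` are generated by the preimages of the
neighbourhoods of `y`, so `y` is a local minimum of `F` iff every point of the fibre is a local
minimum of `F ∘ f`. If the eigenvalues are distinct, any two points of the fibre are related by a
right multiplication `(Q, l) ↦ (Q D, l)` with `D` orthogonal and diagonal. This is a homeomorphism
preserving `f`, so being a local minimum at one point of the fibre is the same as being one at all
of them.
-/

open Filter Topology Matrix

namespace SpecOpt

section LocalMinima

variable {X Y β : Type*} [TopologicalSpace X] [TopologicalSpace Y] [Preorder β]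

theorem isLocalMinOn_iff_forall_fiber {f : X → Y} (hf : Continuous f) (hclosed : IsClosedMap f)
    (hsurj : Function.Surjective f) {F : Y → β} {s : Set Y} {y : Y} :
    IsLocalMinOn F s y ↔ ∀ x, f x = y → IsLocalMinOn (F ∘ f) (f ⁻¹' s) x := by
  have hfiber : IsLocalMinOn F s y ↔ ∀ x, f x = y → ∀ᶠ z in 𝓝 x, f z ∈ s → F y ≤ F (f z) := by
    rw [IsLocalMinOn, IsMinFilter, eventually_nhdsWithin_iff,
      ← map_comap_of_surjective hsurj (𝓝 y), eventually_map, hclosed.comap_nhds_eq hf,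
      eventually_nhdsSet_iff_forall]
    rfl
  rw [hfiber]
  refine forall₂_congr fun x hx => ?_
  rw [IsLocalMinOn, IsMinFilter, eventually_nhdsWithin_iff, ← hx]
  rfl

theorem isLocalMinOn_of_comp_eq_self {φ : X → β} {s : Set X} {g : X → X} {x : X}
    (hg : ContinuousAt g x) (hs : Set.MapsTo g s s) (hφ : φ ∘ g = φ)
    (h : IsLocalMinOn φ s (g x)) : IsLocalMinOn φ s x := by
  rw [← hφ]
  exact h.comp_tendsto (hg.continuousWithinAt.tendsto_nhdsWithin hs)

end LocalMinima

section UnitaryConjugation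

variable {R : Type*} [Monoid R] [StarMul R]

theorem unitary_conj_eq_conj_iff_commute (u v : unitary R) (x : R) :
    (u * x * star u : R) = v * x * star v ↔ Commute (star u * v : R) x := by
  constructor
  · intro h
    calc (star u * v * x : R) = star u * (v * x * star v) * v := by simp [mul_assoc]
      _ = star u * (u * x * star u) * v := by rw [h]
      _ = x * (star u * v) := by simp [← mul_assoc]
  · intro h
    calc (u * x * star u : R) = u * (x * (star u * v)) * star v := by simp [mul_assoc]
      _ = u * (star u * v * x) * star v := by rw [h.eq]
      _ = v * x * star v := by simp [← mul_assoc]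

theorem isClosedMap_unitary_conj [TopologicalSpace R] [ContinuousMul R] [ContinuousStar R]
    [CompactSpace (unitary R)] :
    IsClosedMap fun p : unitary R × R => (p.1 * p.2 * star p.1 : R) := by
  have hcancel (u : unitary R) (x : R) : (u * (star u * x * u) * star u : R) = x := by
    calc (u * (star u * x * u) * star u : R) = u * star u * x * (u * star u) := by
          simp only [mul_assoc]
      _ = x := by simp
  let shear : unitary R × R ≃ₜ unitary R × R :=
    { toFun p := (p.1, p.1 * p.2 * star p.1)
      invFun p := (p.1, star p.1 * p.2 * p.1)
      left_inv p := Prod.ext rfl (by simpa using hcancel (star p.1) p.2)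
      right_inv p := Prod.ext rfl (hcancel p.1 p.2)
      continuous_toFun := by fun_prop
      continuous_invFun := by fun_prop }
  exact isClosedMap_snd_of_compactSpace.comp shear.isClosedMap

end UnitaryConjugation

section Matrices

variable {m : Type*} [DecidableEq m]

theorem isClosedEmbedding_diagonal {α : Type*} [TopologicalSpace α] [T2Space α] [Zero α] :
    IsClosedEmbedding (diagonal : (m → α) → Matrix m m α) :=
  Function.LeftInverse.isClosedEmbedding diag_diagonal (by fun_prop) (by fun_prop)

variable [Fintype m]

instance compactSpace_unitaryGroup {𝕜 : Type*} [RCLike 𝕜] : CompactSpace (unitaryGroup m 𝕜) := by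
  have hcompact : IsCompact {A : Matrix m m 𝕜 | ∀ i j, A i j ∈ Metric.closedBall 0 1} := by
    simpa only [Set.pi, Set.mem_univ, true_imp_iff] using!
      isCompact_univ_pi fun _ : m => isCompact_univ_pi fun _ : m =>
        isCompact_closedBall (0 : 𝕜) 1
  refine isCompact_iff_compactSpace.1 (hcompact.of_isClosed_subset isClosed_unitary ?_)
  exact fun U hU i j => mem_closedBall_zero_iff.2 (entry_norm_bound_of_unitary hU i j)

theorem isDiag_of_commute_diagonal {α : Type*} [CommRing α] [NoZeroDivisors α] {d : m → α}
    (hd : Function.Injective d) {A : Matrix m m α} (h : Commute A (diagonal d)) : A.IsDiag := by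
  intro i j hij
  have hentry : A i j * d j = d i * A i j := by
    simpa only [mul_diagonal, diagonal_mul] using congrFun₂ h.eq i j
  have hzero : (d i - d j) * A i j = 0 := by linear_combination -hentry
  exact (mul_eq_zero.1 hzero).resolve_left (sub_ne_zero.2 (hd.ne hij))

theorem commute_diagonal_of_isDiag {α : Type*} [NonUnitalNonAssocCommSemiring α] {A : Matrix m m α}
    (hA : A.IsDiag) (d : m → α) : Commute A (diagonal d) := by
  rw [← hA.diagonal_diag]
  exact Matrix.commute_diagonal _ _

theorem mul_diagonal_mul_transpose_submatrix {k α : Type*} [Fintype k] [DecidableEq k]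
    [NonUnitalNonAssocSemiring α] (A : Matrix m m α) (d : k → α) (e : k ≃ m) :
    A.submatrix id e * diagonal d * (A.submatrix id e)ᵀ = A * diagonal (d ∘ e.symm) * Aᵀ := by
  have hd : diagonal d = (diagonal (d ∘ e.symm)).submatrix e e := by
    rw [submatrix_diagonal_equiv, Function.comp_assoc, e.symm_comp_self, Function.comp_id]
  rw [hd, transpose_submatrix, submatrix_mul_equiv, submatrix_mul_equiv, submatrix_id_id]

end Matrices

theorem eq_of_antitone_of_map_univ_eq {α : Type*} [PartialOrder α] {n : ℕ} {a b : Fin n → α}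
    (ha : Antitone a) (hb : Antitone b)
    (h : Finset.univ.val.map a = Finset.univ.val.map b) : a = b := by
  rw [Fin.univ_val_map, Fin.univ_val_map, Multiset.coe_eq_coe] at h
  exact List.ofFn_injective (h.eq_of_sortedGE ha.sortedGE_ofFn hb.sortedGE_ofFn)

variable {n p : ℕ}

section SpectralDecomposition

theorem coe_compose (Q : Orth n) (l : EuclideanSpace ℝ (Fin n)) :
    (compose Q l).1 = Q * diagonal l.ofLp * star Q.1 :=
  rfl

theorem compose_eq_compose_iff_commute (Q R : Orth n) (l : EuclideanSpace ℝ (Fin n)) :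
    compose Q l = compose R l ↔ Commute (Q⁻¹ * R).1 (diagonal l.ofLp) := by
  rw [Subtype.ext_iff]
  exact unitary_conj_eq_conj_iff_commute Q R (diagonal l.ofLp)

theorem roots_charpoly_compose (Q : Orth n) (l : EuclideanSpace ℝ (Fin n)) :
    (compose Q l).1.charpoly.roots = Finset.univ.val.map l.ofLp := by
  rw [coe_compose, charpoly_mul_comm, ← mul_assoc, Unitary.coe_star_mul_self, one_mul,
    charpoly_diagonal]
  simpa only [Finset.prod_eq_multiset_prod, Multiset.map_map, Function.comp_def] using
    Polynomial.roots_multiset_prod_X_sub_C (Finset.univ.val.map l.ofLp)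

theorem antitone_eigenvalueVec (X : SymMat n) : Antitone (eigenvalueVec X).ofLp :=
  fun _ _ hij => X.isHermitian.eigenvalues₀_antitone (by simpa using hij)

theorem roots_charpoly_eq_map_eigenvalueVec (X : SymMat n) :
    X.1.charpoly.roots = Finset.univ.val.map (eigenvalueVec X).ofLp := by
  rw [X.isHermitian.roots_charpoly_eq_eigenvalues₀, Fin.univ_val_map, Fin.univ_val_map,
    List.ofFn_congr (Fintype.card_fin n)]
  rfl

/-- The map `(Q, l) ↦ Q Diag(l) Qᵀ`, whose fibre over `X` is the set of spectral decompositions of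
`X`. -/
def recompose (P : Orth n × OrderedVec n) : SymMat n :=
  compose P.1 P.2.1

theorem isSpectralDecomposition_iff {X : SymMat n} {P : Orth n × OrderedVec n} :
    IsSpectralDecomposition X P ↔ recompose P = X :=
  eq_comm

theorem eigenvalueVec_recompose (P : Orth n × OrderedVec n) :
    eigenvalueVec (recompose P) = P.2.1 := by
  refine WithLp.ofLp_injective 2 (eq_of_antitone_of_map_univ_eq (antitone_eigenvalueVec _) P.2.2 ?_)
  rw [← roots_charpoly_eq_map_eigenvalueVec, recompose, roots_charpoly_compose]

theorem continuous_recompose : Continuous (recompose (n := n)) := by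
  unfold recompose compose
  fun_prop

theorem isClosedMap_recompose : IsClosedMap (recompose (n := n)) := by
  have hordered : IsClosedEmbedding fun l : OrderedVec n => diagonal l.1.ofLp :=
    isClosedEmbedding_diagonal.comp <|
      (PiLp.homeomorph 2 fun _ : Fin n => ℝ).isClosedEmbedding.comp <|
        (isClosed_antitone.preimage (PiLp.continuous_ofLp 2 _)).isClosedEmbedding_subtypeVal
  have hval : IsClosedMap fun P : Orth n × OrderedVec n => (recompose P).1 :=
    isClosedMap_unitary_conj.comp (IsClosedEmbedding.id.prodMap hordered).isClosedMap
  exact hval.subtype_mk fun P => (recompose P).2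

theorem surjective_recompose : Function.Surjective (recompose (n := n)) := by
  intro X
  let e : Fin n ≃ Fin n :=
    (finCongr (Fintype.card_fin n)).symm.trans (Fintype.equivOfCardEq (Fintype.card_fin _))
  let U : Orth n := X.isHermitian.eigenvectorUnitary
  have heig : (eigenvalueVec X).ofLp ∘ e.symm = X.isHermitian.eigenvalues := by
    ext i
    simp [Matrix.IsHermitian.eigenvalues, eigenvalueVec, e]
  have hQ : U.1.submatrix id e ∈ orthogonalGroup (Fin n) ℝ := by
    rw [mem_orthogonalGroup_iff, transpose_submatrix, submatrix_mul_equiv,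
      (mem_orthogonalGroup_iff _ _).1 U.2, submatrix_id_id]
  refine ⟨(⟨_, hQ⟩, ⟨eigenvalueVec X, antitone_eigenvalueVec X⟩), Subtype.ext ?_⟩
  refine (mul_diagonal_mul_transpose_submatrix U.1 _ e).trans ?_
  rw [heig]
  exact X.isHermitian.spectral_theorem.symm

theorem exists_isDiag_of_recompose_eq {P R : Orth n × OrderedVec n}
    (hdist : HasDistinctEigenvalues (recompose P)) (h : recompose R = recompose P) :
    ∃ D : Orth n, D.1.IsDiag ∧ P = (R.1 * D, R.2) := by
  have hl : R.2 = P.2 := Subtype.ext <| by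
    rw [← eigenvalueVec_recompose R, h, eigenvalueVec_recompose]
  refine ⟨R.1⁻¹ * P.1, isDiag_of_commute_diagonal hdist ?_, by simp [hl]⟩
  rw [eigenvalueVec_recompose, ← compose_eq_compose_iff_commute, ← hl]
  simpa only [recompose, hl] using h

theorem recompose_mul_isDiag {D : Orth n} (hD : D.1.IsDiag) (P : Orth n × OrderedVec n) :
    recompose (P.1 * D, P.2) = recompose P := by
  refine ((compose_eq_compose_iff_commute _ _ _).2 ?_).symm
  rw [inv_mul_cancel_left]
  exact commute_diagonal_of_isDiag hD _

end SpectralDecomposition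

section LocalMinimaOfDecomposition

theorem hasBasis_nhds_frobDist (A : Matrix (Fin n) (Fin n) ℝ) :
    (𝓝 A).HasBasis (0 < ·) fun δ => {B | frobDist B A ≤ δ} := by
  let := @frobeniusNormedAddCommGroup (Fin n) (Fin n) ℝ _ _ _
  refine Metric.nhds_basis_closedBall.congr (fun _ => Iff.rfl) fun δ _ => ?_
  ext B
  rw [Metric.mem_closedBall, dist_eq_norm]
  rfl

variable {F : SymMat n → ℝ} {G : SymMat n → EuclideanSpace ℝ (Fin p)}
  {C : Set (EuclideanSpace ℝ (Fin n))}

theorem preimage_recompose_feasibleSym :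
    recompose ⁻¹' feasibleSym G C = feasibleDecomp G C := by
  ext P
  simp only [feasibleSym, feasibleDecomp, Set.mem_preimage, Set.mem_ofPred_eq,
    eigenvalueVec_recompose]
  rfl

theorem isLocalMinSym_iff_isLocalMinOn {X : SymMat n} :
    IsLocalMinSym F G C X ↔ IsLocalMinOn F (feasibleSym G C) X := by
  have hbasis := (hasBasis_nhds_frobDist X.1).comap (Subtype.val : SymMat n → _)
  rw [← nhds_induced, ← instTopologicalSpaceSubtype] at hbasis
  rw [IsLocalMinOn, IsMinFilter, eventually_nhdsWithin_iff, hbasis.eventually_iff]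
  exact exists_congr fun δ => and_congr_right fun _ => forall_congr' fun Y => forall_comm

theorem hasBasis_nhds_decomp (P : Orth n × OrderedVec n) :
    (𝓝 P).HasBasis (0 < ·) fun δ : ℝ =>
      {R | frobDist R.1.1 P.1.1 ≤ δ ∧ ‖R.2.1 - P.2.1‖ ≤ δ} := by
  have hQ : (𝓝 P.1).HasBasis (0 < ·) fun δ : ℝ => {Q | frobDist Q.1 P.1.1 ≤ δ} := by
    rw [nhds_subtype]
    exact (hasBasis_nhds_frobDist P.1.1).comap Subtype.val
  have hl : (𝓝 P.2).HasBasis (0 < ·) fun δ : ℝ => {l | ‖l.1 - P.2.1‖ ≤ δ} := by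
    simpa only [← dist_eq_norm, ← Subtype.dist_eq] using! Metric.nhds_basis_closedBall (x := P.2)
  rw [← P.eta, nhds_prod_eq]
  exact hQ.prod_same_index_mono hl (fun _ _ _ _ h _ hR => le_trans hR h)
    (fun _ _ _ _ h _ hR => le_trans hR h)

theorem isLocalMinDecomp_iff_isLocalMinOn {P : Orth n × OrderedVec n} :
    IsLocalMinDecomp F G C P ↔
      IsLocalMinOn (F ∘ recompose) (recompose ⁻¹' feasibleSym G C) P := by
  rw [IsLocalMinOn, IsMinFilter, eventually_nhdsWithin_iff,
    (hasBasis_nhds_decomp P).eventually_iff, preimage_recompose_feasibleSym]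
  refine exists_congr fun δ => and_congr_right fun _ => forall_congr' fun R => ?_
  exact ⟨fun h hR hfeas => h hfeas hR.1 hR.2, fun h hfeas hQ hl => h ⟨hQ, hl⟩ hfeas⟩

theorem isLocalMinSym_iff_forall_isLocalMinDecomp {X : SymMat n} :
    IsLocalMinSym F G C X ↔
      ∀ P, IsSpectralDecomposition X P → IsLocalMinDecomp F G C P := by
  simp only [isLocalMinSym_iff_isLocalMinOn, isLocalMinDecomp_iff_isLocalMinOn,
    isSpectralDecomposition_iff,
    isLocalMinOn_iff_forall_fiber continuous_recompose isClosedMap_recompose surjective_recompose]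

theorem IsLocalMinDecomp.of_recompose_eq {P R : Orth n × OrderedVec n}
    (h : IsLocalMinDecomp F G C P) (hdist : HasDistinctEigenvalues (recompose P))
    (hR : recompose R = recompose P) : IsLocalMinDecomp F G C R := by
  obtain ⟨D, hD, rfl⟩ := exists_isDiag_of_recompose_eq hdist hR
  rw [isLocalMinDecomp_iff_isLocalMinOn] at h ⊢
  refine isLocalMinOn_of_comp_eq_self (g := fun S => (S.1 * D, S.2)) (by fun_prop) ?_ ?_ h
  · exact fun S hS => by rwa [Set.mem_preimage, recompose_mul_isDiag hD]
  · exact funext fun S => congrArg F (recompose_mul_isDiag hD S)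

end LocalMinimaOfDecomposition

end SpecOpt

theorem mainTheorem1 {n p : ℕ} (F : SpecOpt.SymMat n → ℝ)
    (G : SpecOpt.SymMat n → EuclideanSpace ℝ (Fin p))
    (C : Set (EuclideanSpace ℝ (Fin n)))
    (X : SpecOpt.SymMat n) (hX : SpecOpt.HasDistinctEigenvalues X) :
    (SpecOpt.IsLocalMinSym F G C X ↔
      ∃ P, SpecOpt.IsSpectralDecomposition X P ∧ SpecOpt.IsLocalMinDecomp F G C P) ∧
    ((∃ P, SpecOpt.IsSpectralDecomposition X P ∧ SpecOpt.IsLocalMinDecomp F G C P) →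
      ∀ P, SpecOpt.IsSpectralDecomposition X P → SpecOpt.IsLocalMinDecomp F G C P) ∧
    (∀ P, SpecOpt.IsSpectralDecomposition X P →
      (X ∈ SpecOpt.feasibleSym G C ↔ P ∈ SpecOpt.feasibleDecomp G C)) := by
  simp only [SpecOpt.isSpectralDecomposition_iff]
  have hone_all : ∀ P, SpecOpt.recompose P = X → SpecOpt.IsLocalMinDecomp F G C P →
      ∀ R, SpecOpt.recompose R = X → SpecOpt.IsLocalMinDecomp F G C R := by
    rintro P rfl hmin R hR
    exact SpecOpt.IsLocalMinDecomp.of_recompose_eq hmin hX hR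
  refine ⟨?_, fun ⟨P, hP, hmin⟩ => hone_all P hP hmin, ?_⟩
  · rw [SpecOpt.isLocalMinSym_iff_forall_isLocalMinDecomp]
    simp only [SpecOpt.isSpectralDecomposition_iff]
    obtain ⟨P, hP⟩ := SpecOpt.surjective_recompose X
    exact ⟨fun hall => ⟨P, hP, hall P hP⟩, fun ⟨R, hR, hmin⟩ => hone_all R hR hmin⟩
  · rintro P rfl
    rw [← SpecOpt.preimage_recompose_feasibleSym, Set.mem_preimage]
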